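/- **Conventions.** A *metric language* $\mathcal L$ consists of a set of sorts $S$, each with a bound $B_S\ge 0$; constant symbols $c$, each of some sort $S_c$; function symbols $f\colon S_1\times\dots\times S_n\to S$, each with a modulus $\delta^f\colon(0,1]\to(0,1]$; relation symbols $R\colon S_1\times\dots\times S_n\to I_R$, each with a compact interval $I_R\subseteq\mathbb R$ and a modulus $\delta^R\colon(0,1]\to(0,1]$; and, for every sort $S$, a metric symbol $d_S\colon S\times S\to[0,B_S]$. An *$\mathcal L$-structure* $M$ assigns to each sort $S$ a non-empty complete metric space $(S^M,d_S^M)$ of diameter at most $B_S$, to each $c$ an element $c^M\in S_c^M$, and to each $f$ and $R$ maps $f^M\colon\prod_i S_i^M\to S^M$ and $R^M\colon\prod_i S_i^M\to I_R$ such that, for all $\varepsilon\in(0,1]$, $\max_i d(a_i,b_i)<\delta^f(\varepsilon)$ implies $d(f^M(\bar a),f^M(\bar b))\le\varepsilon$, and $\max_i d(a_i,b_i)<\delta^R(\varepsilon)$ implies $|R^M(\bar a)-R^M(\bar b)|\le\varepsilon$. *Terms* are built from variables (infinitely many of each sort) and constant symbols with function symbols. *Formulas* are built from the atomic formulas $R(\tau_1,\dots,\tau_n)$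 and $d_S(\tau_1,\tau_2)$ by continuous connectives $g\colon\mathbb R^n\to\mathbb R$ and the quantifiers $\sup_{x\in S}$ and $\inf_{x\in S}$; they are interpreted in $M$ as real-valued functions $\phi^M$. A *sentence* is a formula without free variables. $M$ is a *model* of a set $\mathrm T$ of sentences, $M\models\mathrm T$, if $\phi^M=0$ for all $\phi\in\mathrm T$. We write $M\equiv N$ if the same sentences have value $0$ in $M$ and in $N$; $\mathrm T$ is a *complete theory* if it has a model and any two of its models are elementarily equivalent. *Isomorphisms* are families of surjections $S^M\to S^N$, one for each sort, that preserve all symbols, the metrics included. The density character $\chi(X)$ of a topological space $X$ is the least cardinality of a dense subset, and $\chi(M):=\sup_S\chi(S^M)$. For formulas in the free variables $\bar x$ put $\|\phi\|_{\mathrm T}:=\sup\{|\phi^M(\bar a)| : M\models\mathrm T,\ \bar a\in M\}$. The language $\mathcal L$ is *separable relative to* $\mathrm T$ if $$\chi(\mathcal L,\mathrm T):=\sum_{(S_1,\dots,S_n)}\chi(\mathrm{Form}_{\bar x}(\mathcal L),\|\cdot\|_{\mathrm T})\le\aleph_0,$$ where the sum is over all finite tuples of sorts, $\bar x=(x_1,\dots,x_n)$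 is a tuple of distinct variables of these sorts, and $\mathrm{Form}_{\bar x}(\mathcal L)$ is the set of formulas with free variables among $\bar x$. A structure is *compact* if all its sorts are compact. For an ultrafilter $\mathcal U$ on $\omega$, the *ultrapower* $M^{\mathcal U}$ has as sorts the quotients of $(S^M)^\omega$ by the pseudometric $\lim_{i\to\mathcal U}d_S^M(a_i,b_i)$, with constants and functions interpreted coordinatewise and relations as $\lim_{i\to\mathcal U}R^M(\bar a_i)$. **Statement.** Assume the Continuum Hypothesis $2^{\aleph_0}=\aleph_1$. Let $\mathrm T$ be a complete theory in a metric language $\mathcal L$ that is separable relative to $\mathrm T$. Let $M$ and $N$ be non-compact models of $\mathrm T$ that are elementarily equivalent and satisfy $\chi(M),\chi(N)\le\mathfrak c=2^{\aleph_0}$. Then, for all nonprincipal ultrafilters $\mathcal U,\mathcal V$ on $\omega$, the ultrapowers $M^{\mathcal U}$ and $N^{\mathcal V}$ are isomorphic. -/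

import Mathlib

universe u w

noncomputable section

/-- A (many-sorted) metric language.  The metric of each sort `S` is a logical symbol, always
available in formulas, with values in `[0, bound S]` and modulus of uniform continuity `ε / 2`;
`Rels` consists of the remaining relation symbols.  Moduli of uniform continuity are functions
`(0, 1] → (0, 1]`. -/
structure MetricLanguage where
  Sorts : Type u
  bound : Sorts → ℝ
  bound_nonneg : ∀ S, 0 ≤ bound S
  Consts : Type u
  constSort : Consts → Sorts
  Funcs : Type u
  funArity : Funcs → ℕ
  funDom : (f : Funcs) → Fin (funArity f) → Sorts
  funCod : Funcs → Sorts
  funMod : Funcs → Set.Ioc (0 : ℝ) 1 → Set.Ioc (0 : ℝ) 1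
  Rels : Type u
  relArity : Rels → ℕ
  relDom : (R : Rels) → Fin (relArity R) → Sorts
  relLo : Rels → ℝ
  relHi : Rels → ℝ
  relLo_le_relHi : ∀ R, relLo R ≤ relHi R
  relMod : Rels → Set.Ioc (0 : ℝ) 1 → Set.Ioc (0 : ℝ) 1

namespace MetricLanguage

/-- A structure for the metric language `L`: every sort is interpreted by a non-empty complete
metric space of diameter at most `bound S`, every function and relation symbol by a map that
respects the prescribed modulus of uniform continuity (and the prescribed range). -/
structure Structure (L : MetricLanguage.{u}) where
  carrier : L.Sorts → Type w
  metric : ∀ S, MetricSpace (carrier S)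
  complete : ∀ S, CompleteSpace (carrier S)
  nonempty : ∀ S, Nonempty (carrier S)
  dist_le_bound : ∀ S (a b : carrier S), dist a b ≤ L.bound S
  const : (c : L.Consts) → carrier (L.constSort c)
  func : (f : L.Funcs) → (∀ k, carrier (L.funDom f k)) → carrier (L.funCod f)
  func_mod : ∀ f (ε : Set.Ioc (0 : ℝ) 1) (a b : ∀ k, carrier (L.funDom f k)),
    (∀ k, dist (a k) (b k) < (L.funMod f ε : ℝ)) → dist (func f a) (func f b) ≤ (ε : ℝ)
  rel : (R : L.Rels) → (∀ k, carrier (L.relDom R k)) → ℝ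
  rel_mem : ∀ R a, rel R a ∈ Set.Icc (L.relLo R) (L.relHi R)
  rel_mod : ∀ R (ε : Set.Ioc (0 : ℝ) 1) (a b : ∀ k, carrier (L.relDom R k)),
    (∀ k, dist (a k) (b k) < (L.relMod R ε : ℝ)) → |rel R a - rel R b| ≤ (ε : ℝ)

attribute [instance] Structure.metric Structure.complete Structure.nonempty

variable {L : MetricLanguage.{u}}

/-! ### Terms, formulas and their interpretation -/

/-- The variables: countably many of each sort. -/
abbrev Var (L : MetricLanguage.{u}) : Type u := L.Sorts × ℕ

/-- Terms, indexed by their sort. -/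
inductive Term (L : MetricLanguage.{u}) : L.Sorts → Type u
  | var (x : L.Var) : Term L x.1
  | const (c : L.Consts) : Term L (L.constSort c)
  | app (f : L.Funcs) (t : ∀ k, Term L (L.funDom f k)) : Term L (L.funCod f)

/-- Formulas.  The connectives are all continuous functions `ℝⁿ → ℝ`, the quantifiers are
`sup` and `inf`. -/
inductive Formula (L : MetricLanguage.{u}) : Type u
  | dist {S : L.Sorts} (t s : Term L S) : Formula L
  | rel (R : L.Rels) (t : ∀ k, Term L (L.relDom R k)) : Formula L
  | conn (n : ℕ) (g : C(Fin n → ℝ, ℝ)) (φ : Fin n → Formula L) : Formula L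
  | sup (x : L.Var) (φ : Formula L) : Formula L
  | inf (x : L.Var) (φ : Formula L) : Formula L

/-- The variables of a term. -/
def Term.vars : {S : L.Sorts} → Term L S → Set L.Var
  | _, .var x => {x}
  | _, .const _ => ∅
  | _, .app _ t => ⋃ k, (t k).vars

/-- The free variables of a formula. -/
def Formula.freeVars : Formula L → Set L.Var
  | .dist t s => t.vars ∪ s.vars
  | .rel _ t => ⋃ k, (t k).vars
  | .conn _ _ φ => ⋃ k, (φ k).freeVars
  | .sup x φ => φ.freeVars \ {x}
  | .inf x φ => φ.freeVars \ {x}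

/-- An assignment of elements of `M` to the variables. -/
abbrev Structure.Assignment (M : Structure.{u, w} L) : Type (max u w) :=
  (x : L.Var) → M.carrier x.1

/-- The value `τ^M` of a term under an assignment. -/
def Term.value (M : Structure.{u, w} L) (v : M.Assignment) :
    {S : L.Sorts} → Term L S → M.carrier S
  | _, .var x => v x
  | _, .const c => M.const c
  | _, .app f t => M.func f fun k => (t k).value M v

open Classical in
/-- The value `φ^M` of a formula under an assignment. -/
def Formula.value (M : Structure.{u, w} L) : Formula L → M.Assignment → ℝ
  | .dist t s, v => Dist.dist (t.value M v) (s.value M v)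
  | .rel R t, v => M.rel R fun k => (t k).value M v
  | .conn _ g φ, v => g fun k => (φ k).value M v
  | .sup x φ, v => ⨆ a : M.carrier x.1, φ.value M (Function.update v x a)
  | .inf x φ, v => ⨅ a : M.carrier x.1, φ.value M (Function.update v x a)

theorem Term.value_congr (M : Structure.{u, w} L) {v v' : M.Assignment} {S : L.Sorts}
    (t : Term L S) (h : ∀ x ∈ t.vars, v x = v' x) : t.value M v = t.value M v' := by
  induction t with
  | var x => exact h x rfl
  | const c => rfl
  | app f t ih =>
    simp only [Term.value]
    congr 1
    funext k
    exact ih k fun x hx => h x (Set.mem_iUnion.2 ⟨k, hx⟩)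

/-- The value of a formula depends only on the values assigned to its free variables; in
particular the value of a sentence is a single real number. -/
theorem Formula.value_congr (M : Structure.{u, w} L) (φ : Formula L) {v v' : M.Assignment}
    (h : ∀ x ∈ φ.freeVars, v x = v' x) : φ.value M v = φ.value M v' := by
  classical
  induction φ generalizing v v' with
  | dist t s =>
    simp only [Formula.value]
    rw [t.value_congr M fun x hx => h x (Or.inl hx), s.value_congr M fun x hx => h x (Or.inr hx)]
  | rel R t =>
    simp only [Formula.value]
    congr 1
    funext k
    exact (t k).value_congr M fun x hx => h x (Set.mem_iUnion.2 ⟨k, hx⟩)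
  | conn n g φ ih =>
    simp only [Formula.value]
    congr 1
    funext k
    exact ih k fun x hx => h x (Set.mem_iUnion.2 ⟨k, hx⟩)
  | sup y φ ih =>
    simp only [Formula.value]
    congr 1
    funext a
    refine ih fun x hx => ?_
    by_cases hxy : x = y
    · subst hxy; simp
    · simp only [Function.update_of_ne hxy]
      exact h x ⟨hx, hxy⟩
  | inf y φ ih =>
    simp only [Formula.value]
    congr 1
    funext a
    refine ih fun x hx => ?_
    by_cases hxy : x = y
    · subst hxy; simp
    · simp only [Function.update_of_ne hxy]
      exact h x ⟨hx, hxy⟩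

/-- The formula `φ - ψ`. -/
def Formula.sub (φ ψ : Formula L) : Formula L :=
  .conn 2 ⟨fun r => r 0 - r 1, by fun_prop⟩ ![φ, ψ]

theorem Formula.value_sub (M : Structure.{u, w} L) (φ ψ : Formula L) (v : M.Assignment) :
    (φ.sub ψ).value M v = φ.value M v - ψ.value M v := by
  simp [Formula.sub, Formula.value]

/-- The formulas with free variables among `x₁, …, xₙ`. -/
def Form {n : ℕ} (x : Fin n → L.Var) : Type u :=
  {φ : Formula L // φ.freeVars ⊆ Set.range x}

/-- Sentences: formulas without free variables. -/
def Sentence (L : MetricLanguage.{u}) : Type u := {φ : Formula L // φ.freeVars = ∅}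

/-! ### Theories -/

/-- `φ^M = 0`, for a sentence `φ` (whose value does not depend on the assignment). -/
def Structure.Satisfies (M : Structure.{u, w} L) (φ : Sentence L) : Prop :=
  ∀ v : M.Assignment, φ.1.value M v = 0

/-- `M` is a model of the set of sentences `T`. -/
def Structure.IsModel (M : Structure.{u, w} L) (T : Set (Sentence L)) : Prop :=
  ∀ φ ∈ T, M.Satisfies φ

/-- The theory of `M`. -/
def Structure.theory (M : Structure.{u, w} L) : Set (Sentence L) := {φ | M.Satisfies φ}

/-- Elementary equivalence. -/
def ElementarilyEquivalent (M N : Structure.{u, w} L) : Prop := M.theory = N.theory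

/-- `T` is a complete theory: it has a model, and any two models of it (with carriers in
`Type w`) are elementarily equivalent. -/
def IsComplete (T : Set (Sentence L)) : Prop :=
  (∃ M : Structure.{u, w} L, M.IsModel T) ∧
    ∀ M N : Structure.{u, w} L, M.IsModel T → N.IsModel T → ElementarilyEquivalent M N

/-! ### Density characters and separability of the language relative to a theory -/

/-- The density character of a topological space: the least cardinality of a dense subset. -/
def densityChar (X : Type w) [TopologicalSpace X] : Cardinal.{w} :=
  sInf {κ | ∃ D : Set X, Dense D ∧ Cardinal.mk D = κ}

/-- The density character of a structure: the supremum of those of its sorts. -/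
def Structure.densityChar (M : Structure.{u, w} L) : Cardinal.{max u w} :=
  ⨆ S : L.Sorts, Cardinal.lift.{u} (MetricLanguage.densityChar (M.carrier S))

/-- The seminorm `‖φ‖_T = sup {|φ^M(a)| : M ⊨ T, a ∈ M}`, as an extended non-negative number,
over the models with carriers in `Type w`.  For `w ≥ u` the downward Löwenheim-Skolem theorem shows
that larger models do not change the supremum; for any `w`, a smaller class of models only makes
separability relative to `T` (and completeness of `T`) a weaker condition. -/
def Formula.normRel (T : Set (Sentence L)) (φ : Formula L) : ENNReal :=
  ⨆ (M : Structure.{u, w} L) (_ : M.IsModel T) (v : M.Assignment), ‖φ.value M v‖ₑ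

/-- The pseudometric `‖φ - ψ‖_T` on the formulas with free variables among `x₁, …, xₙ`. -/
abbrev formMetric (T : Set (Sentence L)) {n : ℕ} (x : Fin n → L.Var) :
    PseudoEMetricSpace (Form x) where
  edist φ ψ := (φ.1.sub ψ.1).normRel.{u, w} T
  edist_self φ := by simp [Formula.normRel, Formula.value_sub]
  edist_comm φ ψ := by
    simp only [Formula.normRel, Formula.value_sub]
    refine iSup_congr fun M => iSup_congr fun _ => iSup_congr fun v => ?_
    rw [← enorm_neg, neg_sub]
  edist_triangle φ ψ χ := by
    simp only [Formula.normRel, Formula.value_sub]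
    refine iSup_le fun M => iSup_le fun hM => iSup_le fun v => ?_
    rw [← sub_add_sub_cancel (φ.1.value M v) (ψ.1.value M v) (χ.1.value M v)]
    refine (enorm_add_le _ _).trans (add_le_add ?_ ?_)
    · exact le_iSup_of_le M (le_iSup_of_le hM (le_iSup_of_le v le_rfl))
    · exact le_iSup_of_le M (le_iSup_of_le hM (le_iSup_of_le v le_rfl))

/-- `χ(Form_x(L), T)`. -/
def formDensityChar (T : Set (Sentence L)) {n : ℕ} (x : Fin n → L.Var) : Cardinal.{u} :=
  @densityChar (Form x) (formMetric.{u, w} T x).toUniformSpace.toTopologicalSpace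

/-- `χ(L, T)`: the sum over all finite tuples of sorts `S₁, …, Sₙ` of the density character
of the formulas in a tuple of distinct variables of these sorts. -/
def langDensityChar (T : Set (Sentence L)) : Cardinal.{u} :=
  Cardinal.sum fun σ : (Σ n : ℕ, Fin n → L.Sorts) =>
    formDensityChar.{u, w} T fun i : Fin σ.1 => ((σ.2 i, (i : ℕ)) : L.Var)

/-- `L` is separable relative to `T`. -/
def IsSeparableRel (T : Set (Sentence L)) : Prop :=
  langDensityChar.{u, w} T ≤ Cardinal.aleph0

/-- A structure is compact if all its sorts are compact. -/
def Structure.IsCompact (M : Structure.{u, w} L) : Prop := ∀ S, CompactSpace (M.carrier S)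

/-! ### Embeddings and isomorphisms -/

/-- Embeddings: families of maps that preserve all symbols, the metrics included. -/
structure Embedding (M N : Structure.{u, w} L) where
  toFun : ∀ S, M.carrier S → N.carrier S
  map_const : ∀ c, toFun _ (M.const c) = N.const c
  map_func : ∀ f a, toFun _ (M.func f a) = N.func f fun k => toFun _ (a k)
  map_rel : ∀ R a, M.rel R a = N.rel R fun k => toFun _ (a k)
  map_dist : ∀ S (a b : M.carrier S), dist a b = dist (toFun S a) (toFun S b)

/-- Two structures are isomorphic if there is an embedding that is surjective on every sort. -/
def Isomorphic (M N : Structure.{u, w} L) : Prop :=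
  ∃ ρ : Embedding M N, ∀ S, Function.Surjective (ρ.toFun S)

/-! ### Ultraproducts -/

section Ultraproduct

open Filter Topology

variable {I : Type}

/-- The limit of a family of real numbers along an ultrafilter; it exists for bounded families,
see `tendsto_ulim`. -/
def ulim (U : Ultrafilter I) (r : I → ℝ) : ℝ := limUnder (U : Filter I) r

theorem tendsto_ulim (U : Ultrafilter I) {r : I → ℝ} {a b : ℝ} (h : ∀ i, r i ∈ Set.Icc a b) :
    Tendsto r U (𝓝 (ulim U r)) := by
  refine tendsto_nhds_limUnder ?_
  obtain ⟨x, -, hx⟩ := (isCompact_Icc (a := a) (b := b)).ultrafilter_le_nhds (U.map r)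
    (by
      rw [le_principal_iff]
      exact Filter.mem_map.2 (Filter.univ_mem' h))
  exact ⟨x, hx⟩

variable (U : Ultrafilter I) (M : I → Structure.{u, w} L)

/-- The product `∏ᵢ S^{Mᵢ}`, to be given the pseudometric `lim_{i → U} d(aᵢ, bᵢ)`. -/
def PreUltra (_U : Ultrafilter I) (M : I → Structure.{u, w} L) (S : L.Sorts) : Type w :=
  ∀ i, (M i).carrier S

variable {U M} in
theorem PreUltra.tendsto_dist {S : L.Sorts} (a b : PreUltra U M S) :
    Tendsto (fun i => dist (a i) (b i)) U (𝓝 (ulim U fun i => dist (a i) (b i))) :=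
  tendsto_ulim U fun i => ⟨dist_nonneg, (M i).dist_le_bound S (a i) (b i)⟩

instance (S : L.Sorts) : PseudoMetricSpace (PreUltra U M S) where
  dist a b := ulim U fun i => dist (a i) (b i)
  dist_self a := tendsto_nhds_unique (PreUltra.tendsto_dist a a) (by simp)
  dist_comm a b := by simp only [dist_comm]
  dist_triangle a b c :=
    le_of_tendsto_of_tendsto' (PreUltra.tendsto_dist a c)
      ((PreUltra.tendsto_dist a b).add (PreUltra.tendsto_dist b c))
      fun i => dist_triangle (a i) (b i) (c i)

variable {U M} in
theorem PreUltra.tendsto_dist_dist {S : L.Sorts} (a b : PreUltra U M S) :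
    Tendsto (fun i => dist (a i) (b i)) U (𝓝 (dist a b)) :=
  PreUltra.tendsto_dist a b

instance (S : L.Sorts) : CompleteSpace (PreUltra U M S) := by
  classical
  refine Metric.complete_of_convergent_controlled_sequences (fun n => 1 / 2 / 2 ^ n)
    (fun n => by positivity) fun s hs => ?_
  -- follow the sequence in each coordinate as long as it is controlled there
  let P : I → ℕ → Prop := fun i n =>
    ∀ k < n, dist (s k i) (s (k + 1) i) ≤ 1 / 2 / 2 ^ k
  have key : ∀ i, ∃ b : (M i).carrier S, ∀ n, P i n → dist (s n i) b ≤ 1 / 2 ^ n := by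
    intro i
    let y : ℕ → (M i).carrier S := fun n => s (Nat.findGreatest (P i) n) i
    have hy : ∀ n, P i n → y n = s n i := by
      intro n hn
      have : Nat.findGreatest (P i) n = n :=
        le_antisymm (Nat.findGreatest_le n) (Nat.le_findGreatest le_rfl hn)
      simp only [y, this]
    have hd : ∀ n, dist (y n) (y (n + 1)) ≤ 1 / 2 / 2 ^ n := by
      intro n
      by_cases h : P i (n + 1)
      · rw [hy _ h, hy n fun k hk => h k (by omega)]
        exact h n (by omega)
      · have : y (n + 1) = y n := by
          simp only [y, Nat.findGreatest_of_not h]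
        rw [this, dist_self]
        positivity
    obtain ⟨b, hb⟩ := cauchySeq_tendsto_of_complete (cauchySeq_of_le_geometric_two hd)
    exact ⟨b, fun n hn => hy n hn ▸ dist_le_of_le_geometric_two_of_tendsto hd hb n⟩
  choose b₀ hb₀ using key
  obtain ⟨b, hb⟩ : ∃ b : PreUltra U M S, ∀ i n, P i n → dist (s n i) (b i) ≤ 1 / 2 ^ n :=
    ⟨b₀, hb₀⟩
  have hP : ∀ n, ∀ᶠ i in (U : Filter I), P i n := by
    intro n
    have h1 : ∀ k, ∀ᶠ i in (U : Filter I), dist (s k i) (s (k + 1) i) ≤ 1 / 2 / 2 ^ k := by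
      intro k
      have := (PreUltra.tendsto_dist_dist (s k) (s (k + 1))).eventually_lt_const
        (hs k k (k + 1) le_rfl (Nat.le_succ k))
      exact this.mono fun i hi => hi.le
    exact (Set.finite_lt_nat n).eventually_all.2 fun k _ => h1 k
  refine ⟨b, ?_⟩
  rw [tendsto_iff_dist_tendsto_zero]
  refine squeeze_zero (g := fun n : ℕ => (1 / 2 : ℝ) ^ n) (fun n => dist_nonneg) (fun n => ?_)
    (tendsto_pow_atTop_nhds_zero_of_lt_one (by norm_num) (by norm_num))
  have : dist (s n) b ≤ 1 / 2 ^ n :=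
    le_of_tendsto (PreUltra.tendsto_dist_dist (s n) b) ((hP n).mono fun i hi => hb i n hi)
  simpa [one_div] using this

instance (S : L.Sorts) : Nonempty (PreUltra U M S) :=
  ⟨fun i => Classical.choice ((M i).nonempty S)⟩

/-- The sort `S` of the ultraproduct: the quotient of the product by `lim_{i → U} d(aᵢ, bᵢ) = 0`,
with the induced metric. -/
abbrev UltraSort (S : L.Sorts) : Type w := SeparationQuotient (PreUltra U M S)

variable {U M}

/-- The class `[(aᵢ)ᵢ]`. -/
def UltraSort.mk {S : L.Sorts} (a : ∀ i, (M i).carrier S) : UltraSort U M S :=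
  SeparationQuotient.mk (X := PreUltra U M S) a

/-- A family representing an element of the ultraproduct. -/
def UltraSort.rep {S : L.Sorts} (a : UltraSort U M S) : ∀ i, (M i).carrier S :=
  Function.surjInv (SeparationQuotient.surjective_mk (X := PreUltra U M S)) a

theorem UltraSort.mk_rep {S : L.Sorts} (a : UltraSort U M S) :
    UltraSort.mk (U := U) (UltraSort.rep a) = a :=
  Function.surjInv_eq (SeparationQuotient.surjective_mk (X := PreUltra U M S)) a

theorem UltraSort.dist_mk {S : L.Sorts} (a b : ∀ i, (M i).carrier S) :
    dist (UltraSort.mk (U := U) a) (UltraSort.mk b) = ulim U fun i => dist (a i) (b i) :=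
  rfl

theorem UltraSort.tendsto_dist {S : L.Sorts} (a b : ∀ i, (M i).carrier S) :
    Tendsto (fun i => dist (a i) (b i)) U
      (𝓝 (dist (UltraSort.mk (U := U) a) (UltraSort.mk b))) :=
  PreUltra.tendsto_dist (U := U) a b

theorem ultra_func_mod (f : L.Funcs) (ε : Set.Ioc (0 : ℝ) 1)
    (a b : ∀ k i, (M i).carrier (L.funDom f k))
    (h : ∀ k, dist (UltraSort.mk (U := U) (a k)) (UltraSort.mk (b k)) < (L.funMod f ε : ℝ)) :
    dist (UltraSort.mk (U := U) fun i => (M i).func f fun k => a k i)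
      (UltraSort.mk fun i => (M i).func f fun k => b k i) ≤ (ε : ℝ) := by
  refine le_of_tendsto (UltraSort.tendsto_dist _ _) ?_
  have := eventually_all.2 fun k =>
    (UltraSort.tendsto_dist (U := U) (a k) (b k)).eventually_lt_const (h k)
  exact this.mono fun i hi => (M i).func_mod f ε _ _ hi

theorem ultra_rel_mod (R : L.Rels) (ε : Set.Ioc (0 : ℝ) 1)
    (a b : ∀ k i, (M i).carrier (L.relDom R k))
    (h : ∀ k, dist (UltraSort.mk (U := U) (a k)) (UltraSort.mk (b k)) < (L.relMod R ε : ℝ)) :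
    |(ulim U fun i => (M i).rel R fun k => a k i) - ulim U fun i => (M i).rel R fun k => b k i|
      ≤ (ε : ℝ) := by
  refine le_of_tendsto (((tendsto_ulim U fun i => (M i).rel_mem R _).sub
    (tendsto_ulim U fun i => (M i).rel_mem R _)).abs) ?_
  have := eventually_all.2 fun k =>
    (UltraSort.tendsto_dist (U := U) (a k) (b k)).eventually_lt_const (h k)
  exact this.mono fun i hi => (M i).rel_mod R ε _ _ hi

variable (U M)

/-- The ultraproduct `∏_{i → U} Mᵢ`.  Functions and relations are computed on representing
families; the result does not depend on their choice, see `ultraproduct_func_mk` and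
`ultraproduct_rel_mk`. -/
def ultraproduct : Structure.{u, w} L where
  carrier := UltraSort U M
  metric _ := inferInstance
  complete _ := inferInstance
  nonempty _ := inferInstance
  dist_le_bound S a b := by
    rw [← UltraSort.mk_rep a, ← UltraSort.mk_rep b]
    exact le_of_tendsto' (UltraSort.tendsto_dist _ _) fun i => (M i).dist_le_bound S _ _
  const c := UltraSort.mk fun i => (M i).const c
  func f a := UltraSort.mk fun i => (M i).func f fun k => (a k).rep i
  func_mod f ε a b h := ultra_func_mod f ε _ _ fun k => by
    simpa only [UltraSort.mk_rep] using h k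
  rel R a := ulim U fun i => (M i).rel R fun k => (a k).rep i
  rel_mem R a := isClosed_Icc.mem_of_tendsto (tendsto_ulim U fun i => (M i).rel_mem R _)
    (Eventually.of_forall fun i => (M i).rel_mem R _)
  rel_mod R ε a b h := ultra_rel_mod R ε _ _ fun k => by
    simpa only [UltraSort.mk_rep] using h k

theorem ultraproduct_func_mk (f : L.Funcs) (a : ∀ k i, (M i).carrier (L.funDom f k)) :
    (ultraproduct U M).func f (fun k => UltraSort.mk (a k)) =
      UltraSort.mk fun i => (M i).func f fun k => a k i := by
  refine dist_le_zero.1 (le_of_forall_pos_le_add fun ε hε => ?_)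
  have hm : min ε 1 ∈ Set.Ioc (0 : ℝ) 1 := ⟨lt_min hε one_pos, min_le_right _ _⟩
  refine (ultra_func_mod f ⟨min ε 1, hm⟩ _ _ fun k => ?_).trans
    ((min_le_left ε 1).trans (zero_add ε).ge)
  rw [UltraSort.mk_rep, dist_self]
  exact (L.funMod f _).2.1

theorem ultraproduct_rel_mk (R : L.Rels) (a : ∀ k i, (M i).carrier (L.relDom R k)) :
    (ultraproduct U M).rel R (fun k => UltraSort.mk (a k)) =
      ulim U fun i => (M i).rel R fun k => a k i := by
  refine eq_of_abs_sub_nonpos (le_of_forall_pos_le_add fun ε hε => ?_)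
  have hm : min ε 1 ∈ Set.Ioc (0 : ℝ) 1 := ⟨lt_min hε one_pos, min_le_right _ _⟩
  refine (ultra_rel_mod R ⟨min ε 1, hm⟩ _ _ fun k => ?_).trans
    ((min_le_left ε 1).trans (zero_add ε).ge)
  rw [UltraSort.mk_rep, dist_self]
  exact (L.relMod R _).2.1

/-- The ultrapower `M^U`. -/
def Structure.ultrapower (N : Structure.{u, w} L) (U : Ultrafilter I) : Structure.{u, w} L :=
  ultraproduct U fun _ => N

end Ultraproduct

end MetricLanguage

end

/-!
The ultrapowers `A = M^U` and `B = N^V` are models of `T`, hence elementarily equivalent, and they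
are isomorphic by a back-and-forth construction of length at most `ω₁`.

*Saturation.* By Łoś's theorem (`Formula.tendsto_value`) the values of formulas in an ultrapower
are limits of the values in the coordinates, so countably many approximately finitely satisfiable
conditions can be realized by a diagonal argument (`exists_realization_ultrapower`). A type over
countably many parameters involves many formulas, but since `L` is separable relative to `T`,
countably many of them are uniformly dense (`IsSeparableRel.exists_countable_formula`).
Hence a tuple of variables that has the same type in `A` and `B` keeps this property when a value
is prescribed for one more variable in `A` and a suitable one is chosen in `B`
(`SameType.exists_update`).

*Size.* A metric space of density character at most `𝔠` has at most `𝔠` points, and so has its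
ultrapower. As there are only countably many sorts, `A` and `B` have at most `𝔠 = ℵ₁` elements
altogether, which can be well-ordered with countable initial segments
(`exists_isWellOrder_countable`).

*Back and forth.* Partial maps are treated as sets of pairs (`IsElementaryRel`). Along the
well-order, a countable elementary relation is extended to every element of `A` and of `B` in turn
(`IsElementaryRel.exists_insert`, `exists_forall_of_countable_extensions`); formulas have finitely
many free variables, so unions of chains stay elementary. The union of all stages is total on both
sides and is the graph of an isomorphism (`IsElementaryRel.isomorphic`).

A tuple of related pairs may contain repetitions while the parameters are enumerated by distinct
variables; this is reconciled by substituting variables for variables (`Formula.exists_rename`).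
-/

noncomputable section

namespace MetricLanguage

variable {L : MetricLanguage.{u}}

/-! ### Formulas: free variables, bounds, renaming of variables -/

theorem Term.finite_vars {S : L.Sorts} (t : Term L S) : t.vars.Finite := by
  induction t with
  | var x => exact Set.finite_singleton x
  | const c => exact Set.finite_empty
  | app f t ih => exact Set.finite_iUnion ih

theorem Formula.finite_freeVars (φ : Formula L) : φ.freeVars.Finite := by
  induction φ with
  | dist t s => exact t.finite_vars.union s.finite_vars
  | rel R t => exact Set.finite_iUnion fun k => (t k).finite_vars
  | conn n g φ ih => exact Set.finite_iUnion ih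
  | sup x φ ih => exact ih.subset Set.sdiff_subset
  | inf x φ ih => exact ih.subset Set.sdiff_subset

/-- Formulas are bounded, uniformly over all structures and assignments. -/
theorem Formula.exists_abs_value_le (φ : Formula L) :
    ∃ C : ℝ, ∀ (M : Structure.{u, w} L) (v : M.Assignment), |φ.value M v| ≤ C := by
  induction φ with
  | @dist S t s =>
    refine ⟨L.bound S, fun M v => ?_⟩
    simp only [Formula.value, abs_of_nonneg dist_nonneg]
    exact M.dist_le_bound S _ _
  | rel R t =>
    refine ⟨max (-L.relLo R) (L.relHi R), fun M v => ?_⟩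
    have h := M.rel_mem R fun k => (t k).value M v
    simp only [Formula.value]
    exact abs_le'.2 ⟨h.2.trans (le_max_right _ _), (neg_le_neg h.1).trans (le_max_left _ _)⟩
  | conn n g φ ih =>
    choose C hC using ih
    have hK : _root_.IsCompact (Set.univ.pi fun k => Set.Icc (-C k) (C k)) :=
      isCompact_univ_pi fun k => isCompact_Icc
    obtain ⟨K, hK⟩ := hK.exists_bound_of_continuousOn g.continuous.continuousOn
    refine ⟨K, fun M v => ?_⟩
    exact hK (fun k => (φ k).value M v) fun k _ => abs_le.1 (hC k M v)
  | sup x φ ih =>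
    obtain ⟨C, hC⟩ := ih
    refine ⟨C, fun M v => ?_⟩
    simp only [Formula.value]
    obtain ⟨a₀⟩ := M.nonempty x.1
    exact abs_le.2 ⟨(abs_le.1 (hC M _)).1.trans
      (le_ciSup ⟨C, Set.forall_mem_range.2 fun a => (abs_le.1 (hC M _)).2⟩ a₀),
      ciSup_le fun a => (abs_le.1 (hC M _)).2⟩
  | inf x φ ih =>
    obtain ⟨C, hC⟩ := ih
    refine ⟨C, fun M v => ?_⟩
    simp only [Formula.value]
    obtain ⟨a₀⟩ := M.nonempty x.1
    exact abs_le.2 ⟨le_ciInf fun a => (abs_le.1 (hC M _)).1,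
      (ciInf_le ⟨-C, Set.forall_mem_range.2 fun a => (abs_le.1 (hC M _)).1⟩ a₀).trans
      (abs_le.1 (hC M _)).2⟩

theorem Formula.bddAbove_range_value (φ : Formula L) (M : Structure.{u, w} L) {ι : Type*}
    (v : ι → M.Assignment) : BddAbove (Set.range fun i => φ.value M (v i)) := by
  obtain ⟨C, hC⟩ := φ.exists_abs_value_le
  exact ⟨C, Set.forall_mem_range.2 fun i => (abs_le.1 (hC M _)).2⟩

theorem Formula.bddBelow_range_value (φ : Formula L) (M : Structure.{u, w} L) {ι : Type*}
    (v : ι → M.Assignment) : BddBelow (Set.range fun i => φ.value M (v i)) := by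
  obtain ⟨C, hC⟩ := φ.exists_abs_value_le
  exact ⟨-C, Set.forall_mem_range.2 fun i => (abs_le.1 (hC M _)).1⟩

theorem Term.exists_rename (σ : L.Var → ℕ) {S : L.Sorts} (t : Term L S) :
    ∃ t' : Term L S, t'.vars ⊆ (fun x => (x.1, σ x)) '' t.vars ∧
      ∀ (M : Structure.{u, w} L) (v : M.Assignment),
        t'.value M v = t.value M fun x => v (x.1, σ x) := by
  induction t with
  | var x => exact ⟨.var (x.1, σ x), by simp [Term.vars], fun M v => rfl⟩
  | const c => exact ⟨.const c, by simp [Term.vars], fun M v => rfl⟩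
  | app f t ih =>
    choose t' ht' h using ih
    refine ⟨.app f t', ?_, fun M v => ?_⟩
    · simp only [Term.vars, Set.image_iUnion]
      exact Set.iUnion_mono ht'
    · simp only [Term.value, h]

/-- An assignment that gives a fresh variable `(x.1, m)` the value `a` restricts, along a renaming
that sends `x` to this variable, to one that gives `x` the value `a`. -/
theorem value_update_rename [DecidableEq L.Var] (M : Structure.{u, w} L) (φ : Formula L)
    (σ : L.Var → ℕ) (x : L.Var) (m : ℕ)
    (hm : (x.1, m) ∉ (fun y : L.Var => (y.1, σ y)) '' φ.freeVars) (v : M.Assignment)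
    (a : M.carrier x.1) :
    φ.value M (fun y => Function.update v (x.1, m) a (y.1, Function.update σ x m y)) =
      φ.value M (Function.update (fun y => v (y.1, σ y)) x a) := by
  refine φ.value_congr M fun y hy => ?_
  by_cases hyx : y = x
  · subst hyx
    simp only [Function.update_self]
    have h : Function.update σ y m y = m := Function.update_self ..
    generalize Function.update σ y m y = k at h
    subst h
    exact Function.update_self ..
  · rw [Function.update_of_ne hyx, Function.update_of_ne hyx, Function.update_of_ne]
    intro h
    exact hm ⟨y, hy, h⟩

theorem image_update_diff_subset [DecidableEq L.Var] (σ : L.Var → ℕ) (x : L.Var) (m : ℕ)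
    (F : Set L.Var) :
    (fun y : L.Var => ((y.1, Function.update σ x m y) : L.Var)) '' F \ {(x.1, m)} ⊆
      (fun y => (y.1, σ y)) '' (F \ {x}) := by
  rintro _ ⟨⟨y, hy, rfl⟩, hne⟩
  have hyx : y ≠ x := by
    rintro rfl
    simp at hne
  exact ⟨y, ⟨hy, hyx⟩, by simp [Function.update_of_ne hyx]⟩

theorem exists_fresh {F : Set L.Var} (hF : F.Finite) (S : L.Sorts) : ∃ m : ℕ, (S, m) ∉ F := by
  by_contra! h
  exact (Set.infinite_range_of_injective (Prod.mk_right_injective S)).mono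
    (Set.range_subset_iff.2 h) hF

/-- Substitution of variables for variables, not necessarily injective: quantified variables
are replaced by fresh ones to avoid capture. -/
theorem Formula.exists_rename (φ : Formula L) (σ : L.Var → ℕ) :
    ∃ φ' : Formula L, φ'.freeVars ⊆ (fun x => (x.1, σ x)) '' φ.freeVars ∧
      ∀ (M : Structure.{u, w} L) (v : M.Assignment),
        φ'.value M v = φ.value M fun x => v (x.1, σ x) := by
  classical
  induction φ generalizing σ with
  | dist t s =>
    obtain ⟨t', ht', ht⟩ := Term.exists_rename.{u, w} σ t
    obtain ⟨s', hs', hs⟩ := Term.exists_rename.{u, w} σ s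
    refine ⟨.dist t' s', ?_, fun M v => ?_⟩
    · simp only [Formula.freeVars, Set.image_union]
      exact Set.union_subset_union ht' hs'
    · simp only [Formula.value, ht, hs]
  | rel R t =>
    choose t' ht' h using fun k => Term.exists_rename.{u, w} σ (t k)
    refine ⟨.rel R t', ?_, fun M v => ?_⟩
    · simp only [Formula.freeVars, Set.image_iUnion]
      exact Set.iUnion_mono ht'
    · simp only [Formula.value, h]
  | conn n g φ ih =>
    choose φ' hφ' h using fun k => ih k σ
    refine ⟨.conn n g φ', ?_, fun M v => ?_⟩
    · simp only [Formula.freeVars, Set.image_iUnion]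
      exact Set.iUnion_mono hφ'
    · simp only [Formula.value, h]
  | sup x φ ih =>
    obtain ⟨m, hm⟩ := exists_fresh (φ.finite_freeVars.image fun y => (y.1, σ y)) x.1
    obtain ⟨φ', hφ', h⟩ := ih (Function.update σ x m)
    refine ⟨.sup (x.1, m) φ', ?_, fun M v => ?_⟩
    · exact (Set.sdiff_subset_sdiff_left hφ').trans (image_update_diff_subset σ x m _)
    · simp only [Formula.value]
      refine iSup_congr fun a => ?_
      convert (h M _).trans (value_update_rename M φ σ x m hm v a)
  | inf x φ ih =>
    obtain ⟨m, hm⟩ := exists_fresh (φ.finite_freeVars.image fun y => (y.1, σ y)) x.1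
    obtain ⟨φ', hφ', h⟩ := ih (Function.update σ x m)
    refine ⟨.inf (x.1, m) φ', ?_, fun M v => ?_⟩
    · exact (Set.sdiff_subset_sdiff_left hφ').trans (image_update_diff_subset σ x m _)
    · simp only [Formula.value]
      refine iInf_congr fun a => ?_
      convert (h M _).trans (value_update_rename M φ σ x m hm v a)

/-- The formula `∑_{j < n} |φ_j - r_j|`. -/
def Formula.deviation {n : ℕ} (φ : Fin n → Formula L) (r : Fin n → ℝ) : Formula L :=
  .conn n ⟨fun t => ∑ j, |t j - r j|, by fun_prop⟩ φ

theorem Formula.value_deviation (M : Structure.{u, w} L) {n : ℕ} (φ : Fin n → Formula L)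
    (r : Fin n → ℝ) (v : M.Assignment) :
    (Formula.deviation φ r).value M v = ∑ j, |(φ j).value M v - r j| :=
  rfl

/-! ### Łoś's theorem -/

section Los

open Filter Topology

variable {I : Type} {U : Ultrafilter I} {M : I → Structure.{u, w} L}

/-- The assignment in the ultraproduct represented by a family of assignments. -/
def ultraAssignment (U : Ultrafilter I) (v : ∀ i, (M i).Assignment) :
    (ultraproduct U M).Assignment :=
  fun x => UltraSort.mk fun i => v i x

theorem exists_eq_ultraAssignment (v : (ultraproduct U M).Assignment) :
    ∃ v' : ∀ i, (M i).Assignment, v = ultraAssignment U v' :=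
  ⟨fun i x => UltraSort.rep (v x) i, funext fun x => (UltraSort.mk_rep (v x)).symm⟩

theorem ultraAssignment_update [DecidableEq L.Var] (v : ∀ i, (M i).Assignment) (x : L.Var)
    (a : ∀ i, (M i).carrier x.1) :
    ultraAssignment U (fun i => Function.update (v i) x (a i)) =
      Function.update (ultraAssignment U v) x (UltraSort.mk a) := by
  funext y
  by_cases hy : y = x
  · subst hy
    refine Eq.trans ?_ (Function.update_self (β := fun z : L.Var => (ultraproduct U M).carrier z.1)
      y (UltraSort.mk a) (ultraAssignment U v)).symm
    simp only [ultraAssignment, Function.update_self]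
    rfl
  · refine Eq.trans ?_ (Function.update_of_ne (β := fun z : L.Var => (ultraproduct U M).carrier z.1)
      hy (UltraSort.mk a) (ultraAssignment U v)).symm
    simp only [ultraAssignment, Function.update_of_ne hy]
    rfl

theorem Term.value_ultraproduct (v : ∀ i, (M i).Assignment) {S : L.Sorts} (t : Term L S) :
    t.value (ultraproduct U M) (ultraAssignment U v) =
      UltraSort.mk fun i => t.value (M i) (v i) := by
  induction t with
  | var x => rfl
  | const c => rfl
  | app f t ih =>
    simp only [Term.value, ih]
    exact ultraproduct_func_mk U M f _

/-- Łoś's theorem. Every formula is bounded, so its values in the coordinates converge along `U`;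
a quantifier is handled by choosing almost optimal elements in all coordinates. -/
theorem Formula.tendsto_value (φ : Formula L) (v : ∀ i, (M i).Assignment) :
    Tendsto (fun i => φ.value (M i) (v i)) U
      (𝓝 (φ.value (ultraproduct U M) (ultraAssignment U v))) := by
  classical
  induction φ generalizing v with
  | dist t s =>
    simp only [Formula.value, Term.value_ultraproduct]
    exact UltraSort.tendsto_dist _ _
  | rel R t =>
    simp only [Formula.value, Term.value_ultraproduct]
    rw [ultraproduct_rel_mk]
    exact tendsto_ulim U fun i => (M i).rel_mem R _
  | conn n g φ ih =>
    simp only [Formula.value]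
    exact (g.continuous.tendsto _).comp (tendsto_pi_nhds.2 fun k => ih k v)
  | sup x φ ih =>
    obtain ⟨C, hC⟩ := (Formula.sup x φ).exists_abs_value_le
    have hl := tendsto_ulim U fun i => abs_le.1 (hC (M i) (v i))
    convert hl using 2
    refine le_antisymm ?_ (le_of_forall_pos_le_add fun ε hε => ?_)
    · simp only [Formula.value]
      have := (ultraproduct U M).nonempty x.1
      refine ciSup_le fun a => ?_
      obtain ⟨b, rfl⟩ : ∃ b : ∀ i, (M i).carrier x.1, a = UltraSort.mk b :=
        ⟨_, (UltraSort.mk_rep a).symm⟩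
      have h := ih fun i => Function.update (v i) x (b i)
      rw [ultraAssignment_update] at h
      refine le_of_tendsto_of_tendsto' (by convert h) hl fun i => ?_
      simp only [Formula.value]
      convert le_ciSup (φ.bddAbove_range_value (M i) fun a => Function.update (v i) x a) (b i)
    · have hb : ∀ i, ∃ b : (M i).carrier x.1,
          (Formula.sup x φ).value (M i) (v i) - ε ≤ φ.value (M i) (Function.update (v i) x b) := by
        intro i
        have h : (Formula.sup x φ).value (M i) (v i) - ε < (Formula.sup x φ).value (M i) (v i) :=
          sub_lt_self _ hε
        obtain ⟨b, hb⟩ := exists_lt_of_lt_ciSup h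
        exact ⟨b, by convert hb.le⟩
      choose b hb using hb
      have h := ih fun i => Function.update (v i) x (b i)
      rw [ultraAssignment_update] at h
      have h2 := le_of_tendsto_of_tendsto' (hl.sub_const ε) h hb
      refine sub_le_iff_le_add.1 (h2.trans ?_)
      simp only [Formula.value]
      convert le_ciSup (φ.bddAbove_range_value (ultraproduct U M) fun a =>
        Function.update (ultraAssignment U v) x a) (UltraSort.mk b)
  | inf x φ ih =>
    obtain ⟨C, hC⟩ := (Formula.inf x φ).exists_abs_value_le
    have hl := tendsto_ulim U fun i => abs_le.1 (hC (M i) (v i))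
    convert hl using 2
    refine le_antisymm (le_of_forall_pos_le_add fun ε hε => ?_) ?_
    · have hb : ∀ i, ∃ b : (M i).carrier x.1,
          φ.value (M i) (Function.update (v i) x b) ≤ (Formula.inf x φ).value (M i) (v i) + ε := by
        intro i
        have h : (Formula.inf x φ).value (M i) (v i) < (Formula.inf x φ).value (M i) (v i) + ε :=
          lt_add_of_pos_right _ hε
        obtain ⟨b, hb⟩ := exists_lt_of_ciInf_lt h
        exact ⟨b, by convert hb.le⟩
      choose b hb using hb
      have h := ih fun i => Function.update (v i) x (b i)
      rw [ultraAssignment_update] at h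
      have h2 := le_of_tendsto_of_tendsto' h (hl.add_const ε) hb
      refine le_trans ?_ h2
      simp only [Formula.value]
      convert ciInf_le (φ.bddBelow_range_value (ultraproduct U M) fun a =>
        Function.update (ultraAssignment U v) x a) (UltraSort.mk b)
    · simp only [Formula.value]
      have := (ultraproduct U M).nonempty x.1
      refine le_ciInf fun a => ?_
      obtain ⟨b, rfl⟩ : ∃ b : ∀ i, (M i).carrier x.1, a = UltraSort.mk b :=
        ⟨_, (UltraSort.mk_rep a).symm⟩
      have h := ih fun i => Function.update (v i) x (b i)
      rw [ultraAssignment_update] at h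
      refine le_of_tendsto_of_tendsto' hl (by convert h) fun i => ?_
      simp only [Formula.value]
      convert ciInf_le (φ.bddBelow_range_value (M i) fun a => Function.update (v i) x a) (b i)

theorem Structure.IsModel.ultrapower {N : Structure.{u, w} L} {T : Set (Sentence L)}
    (h : N.IsModel T) (U : Ultrafilter I) : (N.ultrapower U).IsModel T := by
  intro φ hφ v
  obtain ⟨v', rfl⟩ := exists_eq_ultraAssignment (M := fun _ => N) v
  refine tendsto_nhds_unique (φ.1.tendsto_value v') ?_
  simp only [h φ hφ _]
  exact tendsto_const_nhds

end Los

/-! ### Consequences of separability -/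

theorem exists_dense_mk_eq (X : Type w) [TopologicalSpace X] :
    ∃ D : Set X, Dense D ∧ Cardinal.mk D = densityChar X :=
  csInf_mem (s := {κ | ∃ D : Set X, Dense D ∧ Cardinal.mk D = κ}) ⟨_, Set.univ, dense_univ, rfl⟩

theorem one_le_formDensityChar (T : Set (Sentence L)) {n : ℕ} (x : Fin n → L.Var) :
    1 ≤ formDensityChar.{u, w} T x := by
  let _ := (formMetric.{u, w} T x).toUniformSpace.toTopologicalSpace
  obtain ⟨D, hD, h⟩ := exists_dense_mk_eq (Form x)
  have : Nonempty (Form x) := ⟨.conn 0 0 Fin.elim0, by simp [Formula.freeVars]⟩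
  have := hD.nonempty.to_subtype
  exact (Cardinal.one_le_iff_ne_zero.2 (Cardinal.mk_ne_zero D)).trans_eq h

theorem IsSeparableRel.countable_sorts {T : Set (Sentence L)} (h : IsSeparableRel.{u, w} T) :
    Countable L.Sorts := by
  have h1 : Countable (Σ n : ℕ, Fin n → L.Sorts) := by
    rw [← Cardinal.mk_le_aleph0_iff]
    refine le_trans ?_ h
    have := Cardinal.sum_le_sum (fun _ : (Σ n : ℕ, Fin n → L.Sorts) => (1 : Cardinal.{u})) _
      fun σ => one_le_formDensityChar.{u, w} T fun i : Fin σ.1 => ((σ.2 i, (i : ℕ)) : L.Var)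
    exact le_trans (by simp) this
  refine Function.Injective.countable
    (f := fun S => (⟨1, fun _ => S⟩ : Σ n : ℕ, Fin n → L.Sorts)) fun S S' hS => ?_
  simpa [funext_iff] using hS

theorem IsSeparableRel.exists_countable_form {T : Set (Sentence L)} (h : IsSeparableRel.{u, w} T)
    {n : ℕ} (σ : Fin n → L.Sorts) :
    ∃ D : Set (Form fun i : Fin n => ((σ i, (i : ℕ)) : L.Var)), D.Countable ∧
      ∀ φ : Form fun i : Fin n => ((σ i, (i : ℕ)) : L.Var), ∀ ε > 0, ∃ ψ ∈ D,
      ∀ M : Structure.{u, w} L, M.IsModel T → ∀ v : M.Assignment,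
        |φ.1.value M v - ψ.1.value M v| ≤ ε := by
  let _ := formMetric.{u, w} T fun i : Fin n => ((σ i, (i : ℕ)) : L.Var)
  obtain ⟨D, hD, hc⟩ := exists_dense_mk_eq (Form fun i : Fin n => ((σ i, (i : ℕ)) : L.Var))
  refine ⟨D, ?_, fun φ ε hε => ?_⟩
  · rw [← Cardinal.le_aleph0_iff_set_countable, hc]
    exact (Cardinal.le_sum (fun σ : (Σ n : ℕ, Fin n → L.Sorts) =>
      formDensityChar.{u, w} T fun i : Fin σ.1 => ((σ.2 i, (i : ℕ)) : L.Var)) ⟨n, σ⟩).trans h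
  · obtain ⟨ψ, hψ, hd⟩ := EMetric.mem_closure_iff.1 (hD φ) (ENNReal.ofReal ε)
      (ENNReal.ofReal_pos.2 hε)
    refine ⟨ψ, hψ, fun M hM v => ?_⟩
    have h1 : ‖(φ.1.sub ψ.1).value M v‖ₑ ≤ ENNReal.ofReal ε :=
      (le_iSup_of_le M (le_iSup_of_le hM (le_iSup_of_le v le_rfl)) :
        _ ≤ (φ.1.sub ψ.1).normRel.{u, w} T).trans hd.le
    rw [Formula.value_sub, ← ofReal_norm, ENNReal.ofReal_le_ofReal_iff hε.le] at h1
    exact h1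

/-- If `L` is separable relative to `T`, countably many formulas, in all variables, approximate
every formula uniformly over the models of `T`, without using additional free variables. -/
theorem IsSeparableRel.exists_countable_formula {T : Set (Sentence L)}
    (h : IsSeparableRel.{u, w} T) :
    ∃ D : Set (Formula L), D.Countable ∧ ∀ φ : Formula L, ∀ ε > 0, ∃ ψ ∈ D,
      ψ.freeVars ⊆ φ.freeVars ∧ ∀ M : Structure.{u, w} L, M.IsModel T → ∀ v : M.Assignment,
        |φ.value M v - ψ.value M v| ≤ ε := by
  classical
  have := h.countable_sorts
  choose D hDc hD using fun n : ℕ => h.exists_countable_form (n := n)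
  -- `τ y` renames the variable `(S, i)` to the `i`-th entry of the list `y`
  let τ : (Σ n : ℕ, Fin n → L.Var) → L.Var → ℕ := fun y x =>
    if hx : x.2 < y.1 then (y.2 ⟨x.2, hx⟩).2 else 0
  choose ren hren_vars hren using fun (σ : L.Var → ℕ) (φ : Formula L) =>
    Formula.exists_rename.{u, w} φ σ
  refine ⟨⋃ y : (Σ n : ℕ, Fin n → L.Var), (fun ψ => ren (τ y) ψ.1) '' D y.1 fun i => (y.2 i).1,
    Set.countable_iUnion fun y => (hDc _ _).image _, fun φ ε hε => ?_⟩
  obtain ⟨n, y, hy⟩ : ∃ (n : ℕ) (y : Fin n → L.Var), Set.range y = φ.freeVars := by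
    have hf := φ.finite_freeVars
    obtain ⟨n, ⟨e⟩⟩ := Finite.exists_equiv_fin (h := hf) φ.freeVars
    exact ⟨n, fun i => e.symm i, by
      rw [Set.range_comp' Subtype.val, e.symm.surjective.range_eq]; simp⟩
  have hpos : ∀ x ∈ φ.freeVars, ∃ i, y i = x := fun x hx => by rwa [← hy] at hx
  let σ : L.Var → ℕ := fun x => if hx : ∃ i, y i = x then hx.choose else 0
  have hσ : ∀ x ∈ φ.freeVars, ∃ i : Fin n, y i = x ∧ σ x = i := fun x hx =>
    ⟨(hpos x hx).choose, (hpos x hx).choose_spec, by simp only [σ, dif_pos (hpos x hx)]⟩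
  have hφ' : (ren σ φ).freeVars ⊆ Set.range fun i : Fin n => (((y i).1, (i : ℕ)) : L.Var) := by
    refine (hren_vars σ φ).trans ?_
    rintro _ ⟨x, hx, rfl⟩
    obtain ⟨i, rfl, hi⟩ := hσ x hx
    exact ⟨i, by simp only [hi]⟩
  obtain ⟨ψ, hψ, hd⟩ := hD n (fun i => (y i).1) ⟨ren σ φ, hφ'⟩ ε hε
  refine ⟨ren (τ ⟨n, y⟩) ψ.1, Set.mem_iUnion.2 ⟨⟨n, y⟩, ψ, hψ, rfl⟩, ?_, fun M hM v => ?_⟩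
  · refine (hren_vars _ _).trans ?_
    rintro _ ⟨x, hx, rfl⟩
    obtain ⟨i, rfl⟩ := ψ.2 hx
    rw [← hy]
    exact ⟨i, by simp [τ]⟩
  · have h1 := hd M hM fun x => v (x.1, τ ⟨n, y⟩ x)
    rw [hren (τ _) ψ.1]
    convert h1 using 3
    simp only [hren]
    refine φ.value_congr M fun x hx => ?_
    obtain ⟨i, hi, hxi⟩ := hσ x hx
    have : τ ⟨n, y⟩ (x.1, σ x) = x.2 := by simp [τ, hxi, hi]
    have h2 : ∀ m, m = x.2 → v (x.1, m) = v x := by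
      rintro m rfl
      rfl
    exact (h2 _ this).symm

/-! ### Countable saturation of ultrapowers -/

section Saturation

open Filter Topology

/-- All formulas in the variables from `W` have the same value in `A` under `v` and in `B` under
`v'`. -/
def SameType (A B : Structure.{u, w} L) (W : Set L.Var) (v : A.Assignment) (v' : B.Assignment) :
    Prop :=
  ∀ φ : Formula L, φ.freeVars ⊆ W → φ.value A v = φ.value B v'

open Classical in
/-- Finitely many conditions that `a` satisfies over `v` in `A` are approximately satisfiable over
`v'` in `B`: the infimum over `x` of their total deviation is a formula with value `0` in `A`. -/
theorem SameType.exists_approx {A B : Structure.{u, w} L} {W : Set L.Var} {v : A.Assignment}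
    {v' : B.Assignment} (h : SameType A B W v v') (x : L.Var) (a : A.carrier x.1) {n : ℕ}
    (φ : Fin n → Formula L) (hφ : ∀ j, (φ j).freeVars ⊆ insert x W) {ε : ℝ} (hε : 0 < ε) :
    ∃ b : B.carrier x.1, ∀ j, |(φ j).value B (Function.update v' x b) -
      (φ j).value A (Function.update v x a)| < ε := by
  let r : Fin n → ℝ := fun j => (φ j).value A (Function.update v x a)
  have hW : (Formula.inf x (Formula.deviation φ r)).freeVars ⊆ W := by
    rintro y ⟨hy, hyx⟩
    obtain ⟨j, hj⟩ := Set.mem_iUnion.1 hy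
    exact (hφ j hj).resolve_left hyx
  have hA : (Formula.inf x (Formula.deviation φ r)).value A v ≤ 0 := by
    simp only [Formula.value]
    refine (ciInf_le ((Formula.deviation φ r).bddBelow_range_value A _) a).trans ?_
    simp [Formula.value_deviation, r]
  rw [h _ hW] at hA
  simp only [Formula.value] at hA
  have := B.nonempty x.1
  obtain ⟨b, hb⟩ := exists_lt_of_ciInf_lt (hA.trans_lt hε)
  refine ⟨b, fun j => lt_of_le_of_lt ?_ hb⟩
  rw [Formula.value_deviation]
  exact Finset.single_le_sum (f := fun j => |(φ j).value B (Function.update v' x b) - r j|)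
    (fun j _ => abs_nonneg _) (Finset.mem_univ j)

open Classical in
/-- Countably many conditions on an element of an ultrapower that are, approximately, finitely
satisfiable are simultaneously satisfiable. In the `i`-th coordinate the element is taken from
a solution of as many of the conditions as hold there, up to the bound `i`, which tends to
infinity along a nonprincipal ultrafilter. -/
theorem exists_realization_ultrapower (N : Structure.{u, w} L) (V : Ultrafilter ℕ)
    (hV : ∀ n : ℕ, V ≠ pure n) (v : (N.ultrapower V).Assignment) (x : L.Var)
    (φ : ℕ → Formula L) (r : ℕ → ℝ)
    (h : ∀ n : ℕ, ∃ b : (N.ultrapower V).carrier x.1, ∀ j ≤ n,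
      |(φ j).value (N.ultrapower V) (Function.update v x b) - r j| < 1 / (n + 1)) :
    ∃ b : (N.ultrapower V).carrier x.1, ∀ j,
      (φ j).value (N.ultrapower V) (Function.update v x b) = r j := by
  obtain ⟨v, rfl⟩ := exists_eq_ultraAssignment (M := fun _ => N) v
  have h' : ∀ n : ℕ, ∃ b : ℕ → N.carrier x.1, ∀ j ≤ n,
      |(φ j).value (N.ultrapower V) (Function.update (ultraAssignment V v) x (UltraSort.mk b))
        - r j| < 1 / (n + 1) := by
    intro n
    obtain ⟨b, hb⟩ := h n
    refine ⟨UltraSort.rep b, ?_⟩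
    convert hb using 6
    exact congrArg (Function.update (ultraAssignment V v) x) (UltraSort.mk_rep b)
  choose b hb using h'
  let P : ℕ → ℕ → Prop := fun i n =>
    ∀ j ≤ n, |(φ j).value N (Function.update (v i) x (b n i)) - r j| < 1 / (n + 1)
  have hP : ∀ n, ∀ᶠ i in (V : Filter ℕ), P i n := by
    intro n
    refine (Set.finite_le_nat n).eventually_all.2 fun j hj => ?_
    have h1 := (φ j).tendsto_value (U := V) (M := fun _ => N)
      fun i => Function.update (v i) x (b n i)
    rw [ultraAssignment_update] at h1
    exact (h1.sub_const (r j)).abs.eventually_lt_const (hb n j hj)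
  have hVtop : (V : Filter ℕ) ≤ atTop := by
    rw [← Nat.cofinite_eq_atTop]
    exact V.le_cofinite_or_eq_pure.resolve_right fun ⟨n, hn⟩ => hV n hn
  let m : ℕ → ℕ := fun i => Nat.findGreatest (P i) i
  have hm : ∀ n, ∀ᶠ i in (V : Filter ℕ), n ≤ m i ∧ P i (m i) := by
    intro n
    filter_upwards [hP n, hVtop (eventually_ge_atTop n)] with i hi hn
    exact ⟨Nat.le_findGreatest hn hi, Nat.findGreatest_spec hn hi⟩
  refine ⟨UltraSort.mk fun i => b (m i) i, fun j => ?_⟩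
  have h1 := (φ j).tendsto_value (U := V) (M := fun _ => N)
    fun i => Function.update (v i) x (b (m i) i)
  rw [ultraAssignment_update] at h1
  refine tendsto_nhds_unique h1 ?_
  rw [Metric.tendsto_nhds]
  intro ε hε
  obtain ⟨n, hn⟩ := exists_nat_one_div_lt hε
  filter_upwards [hm (max n j)] with i hi
  rw [Real.dist_eq]
  refine (hi.2 j ((le_max_right _ _).trans hi.1)).trans_le (le_trans ?_ hn.le)
  exact Nat.one_div_le_one_div ((le_max_left _ _).trans hi.1)

open Classical in
/-- Ultrapowers along nonprincipal ultrafilters on `ℕ` are countably saturated, for languages that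
are separable relative to the theory. -/
theorem SameType.exists_update {T : Set (Sentence L)} (hL : IsSeparableRel.{u, w} T)
    {A N : Structure.{u, w} L} {V : Ultrafilter ℕ} (hV : ∀ n : ℕ, V ≠ pure n)
    (hA : A.IsModel T) (hN : (N.ultrapower V).IsModel T) {W : Set L.Var} {v : A.Assignment}
    {v' : (N.ultrapower V).Assignment} (h : SameType A (N.ultrapower V) W v v') (x : L.Var)
    (a : A.carrier x.1) :
    ∃ b : (N.ultrapower V).carrier x.1, SameType A (N.ultrapower V) (insert x W)
      (Function.update v x a) (Function.update v' x b) := by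
  obtain ⟨D, hDc, hD⟩ := hL.exists_countable_formula
  have hne : {ψ ∈ D | ψ.freeVars ⊆ insert x W}.Nonempty := by
    obtain ⟨ψ, hψ, hv, -⟩ := hD (.conn 0 0 Fin.elim0) 1 one_pos
    exact ⟨ψ, hψ, hv.trans (by simp [Formula.freeVars])⟩
  obtain ⟨φ, hφ⟩ := (hDc.mono (Set.sep_subset D _)).exists_eq_range hne
  have hφW : ∀ j, (φ j).freeVars ⊆ insert x W := fun j =>
    (hφ.symm ▸ Set.mem_range_self j : φ j ∈ {ψ ∈ D | ψ.freeVars ⊆ insert x W}).2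
  obtain ⟨b, hb⟩ := exists_realization_ultrapower N V hV v' x φ
    (fun j => (φ j).value A (Function.update v x a)) fun n => by
      obtain ⟨b, hb⟩ := h.exists_approx x a (fun j : Fin (n + 1) => φ j) (fun j => hφW j)
        (Nat.one_div_pos_of_nat (α := ℝ) (n := n))
      exact ⟨b, fun j hj => hb ⟨j, Nat.lt_succ_of_le hj⟩⟩
  refine ⟨b, fun χ hχ => eq_of_abs_sub_nonpos (le_of_forall_pos_le_add fun ε hε => ?_)⟩
  obtain ⟨ψ, hψD, hψ, happ⟩ := hD χ (ε / 2) (half_pos hε)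
  obtain ⟨j, rfl⟩ : ψ ∈ Set.range φ := hφ ▸ ⟨hψD, hψ.trans hχ⟩
  have h1 := happ A hA (Function.update v x a)
  have h2 := happ _ hN (Function.update v' x b)
  rw [hb j] at h2
  rw [abs_le] at h1 h2 ⊢
  constructor <;> linarith [h1.1, h1.2, h2.1, h2.2]

end Saturation

/-! ### Elementary relations -/

/-- A set `p` of pairs (a partial, possibly multi-valued map from `A` to `B`) is elementary if
formulas have the same value at related tuples. Repetitions in the tuples are allowed. -/
def IsElementaryRel (A B : Structure.{u, w} L) (p : Set (Σ S, A.carrier S × B.carrier S)) : Prop :=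
  ∀ (φ : Formula L) (v : A.Assignment) (v' : B.Assignment),
    (∀ x ∈ φ.freeVars, (⟨x.1, v x, v' x⟩ : Σ S, A.carrier S × B.carrier S) ∈ p) →
      φ.value A v = φ.value B v'

theorem isElementaryRel_empty {A B : Structure.{u, w} L} (h : ElementarilyEquivalent A B) :
    IsElementaryRel A B ∅ := by
  intro φ v v' hφ
  have hφ0 : φ.freeVars = ∅ := Set.eq_empty_of_forall_notMem hφ
  -- the sentence `φ - r`, where `r` is the value of `φ` in `A`
  let ψ : Formula L := .conn 1 ⟨fun t => t 0 - φ.value A v, by fun_prop⟩ fun _ => φ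
  have hψ : ψ.freeVars = ∅ := by simp [ψ, Formula.freeVars, hφ0]
  have hA : (⟨ψ, hψ⟩ : Sentence L) ∈ A.theory := fun v₁ => by
    have : φ.value A v₁ = φ.value A v := φ.value_congr A fun x hx => by simp [hφ0] at hx
    simp [ψ, Formula.value, this]
  rw [h] at hA
  have hB := hA v'
  simp only [ψ, Formula.value, ContinuousMap.coe_mk] at hB
  linarith

theorem IsElementaryRel.sUnion {A B : Structure.{u, w} L} (h0 : ElementarilyEquivalent A B)
    {c : Set (Set (Σ S, A.carrier S × B.carrier S))} (hc : IsChain (· ⊆ ·) c)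
    (h : ∀ p ∈ c, IsElementaryRel A B p) : IsElementaryRel A B (⋃₀ c) := by
  rcases c.eq_empty_or_nonempty with rfl | hne
  · simpa using isElementaryRel_empty h0
  intro φ v v' hφ
  let z : L.Var → Σ S, A.carrier S × B.carrier S := fun x => ⟨x.1, v x, v' x⟩
  have hz : z '' φ.freeVars ⊆ ⋃₀ c := Set.image_subset_iff.2 hφ
  obtain ⟨p, hp, hsub⟩ := hc.directedOn.exists_mem_subset_of_finite_of_subset_sUnion hne
    (φ.finite_freeVars.image z) hz
  exact h p hp φ v v' fun x hx => hsub ⟨x, hx, rfl⟩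

/-- The converse of a relation between two structures. -/
def converse {A B : Structure.{u, w} L} (p : Set (Σ S, A.carrier S × B.carrier S)) :
    Set (Σ S, B.carrier S × A.carrier S) :=
  {z | ⟨z.1, z.2.2, z.2.1⟩ ∈ p}

theorem IsElementaryRel.converse {A B : Structure.{u, w} L}
    {p : Set (Σ S, A.carrier S × B.carrier S)} (h : IsElementaryRel A B p) :
    IsElementaryRel B A (converse p) :=
  fun φ v v' hφ => (h φ v' v hφ).symm

theorem countable_converse {A B : Structure.{u, w} L} {p : Set (Σ S, A.carrier S × B.carrier S)}
    (h : p.Countable) : (converse p).Countable := by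
  refine h.preimage_of_injOn (f := fun z : Σ S, B.carrier S × A.carrier S =>
    (⟨z.1, z.2.2, z.2.1⟩ : Σ S, A.carrier S × B.carrier S)) ?_
  rintro ⟨S, b, a⟩ - ⟨S', b', a'⟩ - h
  obtain ⟨rfl, h⟩ := Sigma.mk.inj_iff.1 h
  obtain ⟨rfl, rfl⟩ := Prod.mk_inj.1 (eq_of_heq h)
  rfl

/-- One step of the back-and-forth construction. The pairs in `p` are enumerated by the variables
`(S, n + 1)`, which leaves a variable for the new element; coincidences among the elements of an
arbitrary tuple are accounted for by renaming. -/
theorem IsElementaryRel.exists_insert {T : Set (Sentence L)} (hL : IsSeparableRel.{u, w} T)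
    {A N : Structure.{u, w} L} {V : Ultrafilter ℕ} (hV : ∀ n : ℕ, V ≠ pure n)
    (hA : A.IsModel T) (hN : (N.ultrapower V).IsModel T)
    {p : Set (Σ S, A.carrier S × (N.ultrapower V).carrier S)}
    (hp : IsElementaryRel A (N.ultrapower V) p) (hpc : p.Countable) (S : L.Sorts)
    (a : A.carrier S) :
    ∃ b : (N.ultrapower V).carrier S, IsElementaryRel A (N.ultrapower V) (insert ⟨S, a, b⟩ p) := by
  classical
  generalize hB : N.ultrapower V = B at *
  let fib : ∀ S, Set (A.carrier S × B.carrier S) := fun S => {z | ⟨S, z⟩ ∈ p}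
  have hfib : ∀ S, ∃ g : ℕ → A.carrier S × B.carrier S, (fib S).Nonempty → fib S = Set.range g := by
    intro S
    by_cases hne : (fib S).Nonempty
    · have hc : (fib S).Countable := hpc.preimage sigma_mk_injective
      obtain ⟨g, hg⟩ := hc.exists_eq_range hne
      exact ⟨g, fun _ => hg⟩
    · obtain ⟨a₀⟩ := A.nonempty S
      obtain ⟨b₀⟩ := B.nonempty S
      exact ⟨fun _ => (a₀, b₀), fun h => absurd h hne⟩
  choose g hg using hfib
  let W : Set L.Var := {x | x.2 ≠ 0 ∧ (fib x.1).Nonempty}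
  let v : A.Assignment := fun x => (g x.1 (x.2 - 1)).1
  let v' : B.Assignment := fun x => (g x.1 (x.2 - 1)).2
  have hvv : SameType A B W v v' := fun φ hφ => hp φ v v' fun x hx => by
    have h : g x.1 (x.2 - 1) ∈ fib x.1 := hg x.1 (hφ hx).2 ▸ Set.mem_range_self _
    exact h
  let x₀ : L.Var := (S, 0)
  subst hB
  obtain ⟨b, hb⟩ := hvv.exists_update hL hV hA hN x₀ a
  refine ⟨b, fun φ t t' ht => ?_⟩
  have hσ : ∀ x : L.Var, ∃ m : ℕ, x ∈ φ.freeVars → (x.1, m) ∈ insert x₀ W ∧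
      Function.update v x₀ a (x.1, m) = t x ∧ Function.update v' x₀ b (x.1, m) = t' x := by
    intro x
    by_cases hx : x ∈ φ.freeVars
    · rcases ht x hx with h | h
      · obtain ⟨S', k⟩ := x
        obtain ⟨h1, h⟩ := Sigma.mk.inj_iff.1 h
        dsimp only at h1
        subst h1
        obtain ⟨h1, h2⟩ := Prod.mk_inj.1 (eq_of_heq h)
        refine ⟨0, fun _ => ⟨Or.inl rfl, ?_, ?_⟩⟩
        · rw [h1]
          exact Function.update_self (β := fun z : L.Var => A.carrier z.1) ..
        · rw [h2]
          exact Function.update_self (β := fun z : L.Var => (N.ultrapower V).carrier z.1) ..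
      · have hmem : (t x, t' x) ∈ fib x.1 := h
        obtain ⟨k, hk⟩ : (t x, t' x) ∈ Set.range (g x.1) := hg x.1 ⟨_, hmem⟩ ▸ hmem
        have hne : ((x.1, k + 1) : L.Var) ≠ x₀ := fun h => by simp [x₀] at h
        refine ⟨k + 1, fun _ => ⟨Or.inr ⟨Nat.succ_ne_zero k, _, hmem⟩, ?_, ?_⟩⟩
        · rw [Function.update_of_ne hne]
          simp [v, hk]
        · rw [Function.update_of_ne hne]
          simp [v', hk]
    · exact ⟨0, fun h => absurd h hx⟩
  choose σ hσ using hσ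
  obtain ⟨φ', hφ', hval⟩ := Formula.exists_rename.{u, w} φ σ
  have h := hb φ' (hφ'.trans (by rintro _ ⟨x, hx, rfl⟩; exact (hσ x hx).1))
  rw [hval, hval] at h
  rw [← φ.value_congr A fun x hx => (hσ x hx).2.1,
    ← φ.value_congr (N.ultrapower V) fun x hx => (hσ x hx).2.2]
  exact h

/-- The step in the other direction, obtained by passing to the converse relation. -/
theorem IsElementaryRel.exists_insert' {T : Set (Sentence L)} (hL : IsSeparableRel.{u, w} T)
    {M B : Structure.{u, w} L} {U : Ultrafilter ℕ} (hU : ∀ n : ℕ, U ≠ pure n)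
    (hM : (M.ultrapower U).IsModel T) (hB : B.IsModel T)
    {p : Set (Σ S, (M.ultrapower U).carrier S × B.carrier S)}
    (hp : IsElementaryRel (M.ultrapower U) B p) (hpc : p.Countable) (S : L.Sorts)
    (b : B.carrier S) :
    ∃ a : (M.ultrapower U).carrier S, IsElementaryRel (M.ultrapower U) B (insert ⟨S, a, b⟩ p) := by
  obtain ⟨a, ha⟩ := hp.converse.exists_insert hL hU hB hM (countable_converse hpc) S b
  refine ⟨a, fun φ v v' hφ => ha.converse φ v v' fun x hx => ?_⟩
  rcases hφ x hx with h | h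
  · refine Or.inl ?_
    obtain ⟨S', k⟩ := x
    obtain ⟨h1, h⟩ := Sigma.mk.inj_iff.1 h
    dsimp only at h1
    subst h1
    obtain ⟨h1, h2⟩ := Prod.mk_inj.1 (eq_of_heq h)
    simp only [h1, h2]
  · exact Or.inr h

theorem exists_assignment_eq (A : Structure.{u, w} L) {ι : Type} [Encodable ι] (S : ι → L.Sorts)
    (a : ∀ k, A.carrier (S k)) : ∃ v : A.Assignment, ∀ k, v (S k, Encodable.encode k) = a k := by
  have h : ∀ x : L.Var, ∃ c : A.carrier x.1,
      ∀ k, ((S k, Encodable.encode k) : L.Var) = x → HEq c (a k) := by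
    intro x
    by_cases hx : ∃ k, ((S k, Encodable.encode k) : L.Var) = x
    · obtain ⟨k, rfl⟩ := hx
      refine ⟨a k, fun k' h => ?_⟩
      obtain rfl : k' = k := Encodable.encode_injective (congrArg Prod.snd h)
      rfl
    · obtain ⟨c⟩ := A.nonempty x.1
      exact ⟨c, fun k h => absurd ⟨k, h⟩ hx⟩
  choose v hv using h
  exact ⟨v, fun k => eq_of_heq (hv _ k rfl)⟩

/-- Any countable tuple of related elements can be named by variables. -/
theorem IsElementaryRel.value_eq {A B : Structure.{u, w} L}
    {p : Set (Σ S, A.carrier S × B.carrier S)} (hp : IsElementaryRel A B p) {ι : Type}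
    [Encodable ι] (S : ι → L.Sorts) (a : ∀ k, A.carrier (S k)) (b : ∀ k, B.carrier (S k))
    (h : ∀ k, ⟨S k, a k, b k⟩ ∈ p) :
    ∃ (v : A.Assignment) (v' : B.Assignment), (∀ k, v (S k, Encodable.encode k) = a k) ∧
      (∀ k, v' (S k, Encodable.encode k) = b k) ∧
      ∀ φ : Formula L, φ.freeVars ⊆ Set.range (fun k => (S k, Encodable.encode k)) →
        φ.value A v = φ.value B v' := by
  obtain ⟨v, hv⟩ := exists_assignment_eq A S a
  obtain ⟨v', hv'⟩ := exists_assignment_eq B S b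
  refine ⟨v, v', hv, hv', fun φ hφ => hp φ v v' fun x hx => ?_⟩
  obtain ⟨k, rfl⟩ := hφ hx
  simpa only [hv, hv'] using h k

theorem IsElementaryRel.dist_eq {A B : Structure.{u, w} L}
    {p : Set (Σ S, A.carrier S × B.carrier S)} (hp : IsElementaryRel A B p) {S : L.Sorts}
    {a a' : A.carrier S} {b b' : B.carrier S} (h : ⟨S, a, b⟩ ∈ p) (h' : ⟨S, a', b'⟩ ∈ p) :
    dist a a' = dist b b' := by
  obtain ⟨v, v', hv, hv', hval⟩ := hp.value_eq (fun _ : Bool => S) (fun k => cond k a' a)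
    (fun k => cond k b' b) (fun k => by cases k <;> assumption)
  have := hval (.dist (.var (S, Encodable.encode false)) (.var (S, Encodable.encode true))) (by
    rintro x (hx | hx)
    · exact ⟨false, hx.symm⟩
    · exact ⟨true, hx.symm⟩)
  simp only [Formula.value, Term.value] at this
  rw [hv false, hv true, hv' false, hv' true] at this
  exact this

/-- An elementary relation that is total on both sides is the graph of an isomorphism. -/
theorem IsElementaryRel.isomorphic {A B : Structure.{u, w} L}
    {p : Set (Σ S, A.carrier S × B.carrier S)} (hp : IsElementaryRel A B p)
    (hA : ∀ S (a : A.carrier S), ∃ b, ⟨S, a, b⟩ ∈ p)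
    (hB : ∀ S (b : B.carrier S), ∃ a, ⟨S, a, b⟩ ∈ p) : Isomorphic A B := by
  choose F hF using hA
  refine ⟨⟨F, fun c => ?_, fun f a => ?_, fun R a => ?_,
    fun S a a' => hp.dist_eq (hF S a) (hF S a')⟩, fun S b => ?_⟩
  · obtain ⟨v, v', hv, hv', hval⟩ := hp.value_eq (fun _ : Unit => L.constSort c)
      (fun _ => A.const c) (fun _ => F _ (A.const c)) (fun _ => hF _ _)
    have := hval (.dist (.var (L.constSort c, Encodable.encode ())) (.const c)) (by
      rintro x (hx | hx)
      · exact ⟨(), hx.symm⟩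
      · exact absurd hx (Set.notMem_empty x))
    simp only [Formula.value, Term.value] at this
    rw [hv (), hv' (), dist_self] at this
    exact dist_eq_zero.1 this.symm
  · -- `none` stands for the value of `f`, and `some k` for its `k`-th argument
    let S : Option (Fin (L.funArity f)) → L.Sorts := fun o => o.elim (L.funCod f) (L.funDom f)
    let z : ∀ o, A.carrier (S o) := fun o => match o with
      | none => A.func f a
      | some k => a k
    obtain ⟨v, v', hv, hv', hval⟩ := hp.value_eq S z (fun o => F _ (z o)) (fun o => hF _ _)
    have key : dist (v (S none, Encodable.encode (none : Option (Fin (L.funArity f)))))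
          (A.func f fun k => v (S (some k), Encodable.encode (some k))) =
        dist (v' (S none, Encodable.encode (none : Option (Fin (L.funArity f)))))
          (B.func f fun k => v' (S (some k), Encodable.encode (some k))) :=
      hval (.dist (.var (S none, Encodable.encode (none : Option (Fin (L.funArity f)))))
        (.app f fun k => .var (S (some k), Encodable.encode (some k)))) (by
        rintro x (hx | hx)
        · exact ⟨none, hx.symm⟩
        · obtain ⟨k, hk⟩ := Set.mem_iUnion.1 hx
          exact ⟨some k, Eq.symm hk⟩)
    have h1 : (fun k => v (S (some k), Encodable.encode (some k))) = a :=
      funext fun k => hv (some k)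
    have h2 : (fun k => v' (S (some k), Encodable.encode (some k))) = fun k => F _ (a k) :=
      funext fun k => hv' (some k)
    rw [hv none, hv' none, h1, h2] at key
    exact dist_eq_zero.1 (key.symm.trans (dist_self (A.func f a)))
  · obtain ⟨v, v', hv, hv', hval⟩ := hp.value_eq (L.relDom R) a (fun k => F _ (a k))
      (fun k => hF _ _)
    have := hval (.rel R fun k => .var (L.relDom R k, Encodable.encode k)) (by
      intro x hx
      obtain ⟨k, hk⟩ := Set.mem_iUnion.1 hx
      exact ⟨k, Eq.symm hk⟩)
    simpa only [Formula.value, Term.value, hv, hv'] using this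
  · obtain ⟨a, ha⟩ := hB S b
    refine ⟨a, dist_eq_zero.1 ?_⟩
    rw [← hp.dist_eq (hF S a) ha, dist_self]

/-! ### Transfinite recursion and cardinalities -/

/-- Suppose that every countable set with property `Q` extends to one that moreover meets the
requirement `R j`. If the requirements are well-ordered with countable initial segments, they can be
met simultaneously, by a transfinite recursion in which every stage is countable. -/
theorem exists_forall_of_countable_extensions {X J : Type*} (r : J → J → Prop) [IsWellOrder J r]
    (hr : ∀ j, {i | r i j}.Countable) {Q : Set X → Prop}
    (hQ : ∀ c : Set (Set X), IsChain (· ⊆ ·) c → (∀ q ∈ c, Q q) → Q (⋃₀ c))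
    {R : J → Set X → Prop} (hR : ∀ j q q', q ⊆ q' → R j q → R j q')
    (step : ∀ j q, q.Countable → Q q → ∃ q', q'.Countable ∧ Q q' ∧ q ⊆ q' ∧ R j q') :
    ∃ q, Q q ∧ ∀ j, R j q := by
  have step' : ∀ j q, ∃ q', q.Countable ∧ Q q → q'.Countable ∧ Q q' ∧ q ⊆ q' ∧ R j q' := by
    intro j q
    by_cases h : q.Countable ∧ Q q
    · obtain ⟨q', hq'⟩ := step j q h.1 h.2
      exact ⟨q', fun _ => hq'⟩
    · exact ⟨q, fun h' => absurd h' h⟩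
  choose f hf using step'
  let p : J → Set X := IsWellFounded.fix r fun j ih => f j (⋃ i : {i // r i j}, ih i.1 i.2)
  have hp : ∀ j, p j = f j (⋃ i : {i // r i j}, p i.1) := fun j => IsWellFounded.fix_eq r _ j
  have main : ∀ j, (p j).Countable ∧ Q (p j) ∧ (⋃ i : {i // r i j}, p i.1) ⊆ p j ∧ R j (p j) := by
    intro j
    induction j using IsWellFounded.induction r with
    | ind j ih =>
      rw [hp j]
      refine hf j _ ⟨?_, ?_⟩
      · have : Countable {i // r i j} := (hr j).to_subtype
        exact Set.countable_iUnion fun i => (ih i.1 i.2).1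
      · rw [← Set.sUnion_range]
        refine hQ _ ?_ (Set.forall_mem_range.2 fun i => (ih i.1 i.2).2.1)
        rintro _ ⟨i, rfl⟩ _ ⟨i', rfl⟩ -
        rcases trichotomous_of r i.1 i'.1 with h | h | h
        · exact Or.inl ((Set.subset_iUnion (fun k : {k // r k i'.1} => p k.1) ⟨i.1, h⟩).trans
            (ih i'.1 i'.2).2.2.1)
        · exact Or.inl (by simp only [h, subset_refl])
        · exact Or.inr ((Set.subset_iUnion (fun k : {k // r k i.1} => p k.1) ⟨i'.1, h⟩).trans
            (ih i.1 i.2).2.2.1)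
  refine ⟨⋃₀ Set.range p, hQ _ ?_ (Set.forall_mem_range.2 fun j => (main j).2.1), fun j =>
    hR j _ _ (Set.subset_sUnion_of_mem (Set.mem_range_self j)) (main j).2.2.2⟩
  rintro _ ⟨i, rfl⟩ _ ⟨i', rfl⟩ -
  rcases trichotomous_of r i i' with h | h | h
  · exact Or.inl ((Set.subset_iUnion (fun k : {k // r k i'} => p k.1) ⟨i, h⟩).trans
      (main i').2.2.1)
  · exact Or.inl (by rw [h])
  · exact Or.inr ((Set.subset_iUnion (fun k : {k // r k i} => p k.1) ⟨i', h⟩).trans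
      (main i).2.2.1)

open Cardinal Topology in
theorem mk_le_continuum_of_densityChar_le {X : Type w} [MetricSpace X]
    (h : densityChar X ≤ Cardinal.continuum) : Cardinal.mk X ≤ Cardinal.continuum := by
  obtain ⟨D, hD, hc⟩ := exists_dense_mk_eq X
  have hseq : ∀ x : X, ∃ s : ℕ → D, Filter.Tendsto (fun n => (s n : X)) Filter.atTop (𝓝 x) := by
    intro x
    obtain ⟨s, hs, hlim⟩ := mem_closure_iff_seq_limit.1 (hD x)
    exact ⟨fun n => ⟨s n, hs n⟩, hlim⟩
  choose s hs using hseq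
  have hinj : Function.Injective s := fun x y hxy =>
    tendsto_nhds_unique (hs x) (by rw [hxy]; exact hs y)
  calc Cardinal.mk X ≤ Cardinal.mk (ℕ → D) := Cardinal.mk_le_of_injective hinj
    _ = Cardinal.mk D ^ ℵ₀ := by simp
    _ ≤ 𝔠 ^ ℵ₀ := Cardinal.power_le_power_right (hc.trans_le h)
    _ = 𝔠 := Cardinal.continuum_power_aleph0

open Cardinal in
theorem Structure.mk_ultrapower_le_continuum [Countable L.Sorts] {M : Structure.{u, w} L}
    (h : M.densityChar ≤ Cardinal.continuum) (U : Ultrafilter ℕ) :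
    Cardinal.mk (Σ S, (M.ultrapower U).carrier S) ≤ Cardinal.continuum := by
  have hM : ∀ S, #(M.carrier S) ≤ 𝔠 := fun S => by
    refine mk_le_continuum_of_densityChar_le ?_
    have := (le_ciSup bddAbove_of_small S).trans h
    simpa using this
  have hU : ∀ S, #((M.ultrapower U).carrier S) ≤ 𝔠 := fun S =>
    calc #((M.ultrapower U).carrier S) ≤ #(ℕ → M.carrier S) :=
          mk_le_of_surjective (f := fun a => UltraSort.mk (U := U) (M := fun _ => M) a)
            fun b => ⟨UltraSort.rep b, UltraSort.mk_rep b⟩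
      _ = #(M.carrier S) ^ ℵ₀ := by simp
      _ ≤ 𝔠 ^ ℵ₀ := power_le_power_right (hM S)
      _ = 𝔠 := continuum_power_aleph0
  calc #(Σ S, (M.ultrapower U).carrier S) = sum fun S => #((M.ultrapower U).carrier S) :=
        mk_sigma _
    _ ≤ sum fun _ : L.Sorts => 𝔠 := sum_le_sum _ _ hU
    _ ≤ ℵ₀ * 𝔠 := by
      rw [sum_const]
      exact mul_le_mul' (by simp) (by simp)
    _ = 𝔠 := aleph0_mul_continuum

/-- Under the continuum hypothesis, a set with at most `𝔠` elements has a well-order with countable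
initial segments. -/
theorem exists_isWellOrder_countable {Y : Type w} (CH : Cardinal.continuum.{0} = Cardinal.aleph 1)
    (h : Cardinal.mk Y ≤ Cardinal.continuum) :
    ∃ (r : Y → Y → Prop) (_ : IsWellOrder Y r), ∀ j, {i | r i j}.Countable := by
  have hCH : Cardinal.continuum.{w} = Cardinal.aleph 1 := by
    simpa using congrArg Cardinal.lift.{w} CH
  obtain ⟨r, hwo, hr⟩ := Cardinal.exists_ord_eq Y
  refine ⟨r, hwo, fun j => ?_⟩
  have := Cardinal.card_typein_lt j hr
  rw [Ordinal.card_typein] at this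
  rw [← Cardinal.le_aleph0_iff_set_countable, ← Cardinal.lt_aleph_one_iff]
  exact this.trans_le (h.trans_eq hCH)

end MetricLanguage

theorem corollary4p2
    (CH : Cardinal.continuum.{0} = Cardinal.aleph 1)
    {L : MetricLanguage.{u}} (T : Set (MetricLanguage.Sentence L))
    (hT : MetricLanguage.IsComplete.{u, w} T)
    (hL : MetricLanguage.IsSeparableRel.{u, w} T)
    (M N : MetricLanguage.Structure.{u, w} L)
    (hM : M.IsModel T) (hN : N.IsModel T)
    (hMN : MetricLanguage.ElementarilyEquivalent M N)
    (hMc : ¬ M.IsCompact) (hNc : ¬ N.IsCompact)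
    (hMd : M.densityChar ≤ Cardinal.continuum) (hNd : N.densityChar ≤ Cardinal.continuum)
    (U V : Ultrafilter ℕ) (hU : ∀ n : ℕ, U ≠ pure n) (hV : ∀ n : ℕ, V ≠ pure n) :
    MetricLanguage.Isomorphic (M.ultrapower U) (N.ultrapower V) := by
  open MetricLanguage in
  have hcount := hL.countable_sorts
  have hA := hM.ultrapower U
  have hB := hN.ultrapower V
  have hAB := hT.2 _ _ hA hB
  obtain ⟨r, hwo, hr⟩ := exists_isWellOrder_countable
    (Y := (Σ S, (M.ultrapower U).carrier S) ⊕ (Σ S, (N.ultrapower V).carrier S)) CH (by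
      rw [Cardinal.mk_sum, Cardinal.lift_id, Cardinal.lift_id]
      exact (add_le_add (Structure.mk_ultrapower_le_continuum hMd U)
        (Structure.mk_ultrapower_le_continuum hNd V)).trans_eq Cardinal.continuum_add_self)
  obtain ⟨p, hp, hR⟩ := exists_forall_of_countable_extensions r hr
    (Q := IsElementaryRel (M.ultrapower U) (N.ultrapower V))
    (fun c hc h => IsElementaryRel.sUnion hAB hc h)
    (R := Sum.elim (fun a p => ∃ b, ⟨a.1, a.2, b⟩ ∈ p) (fun b p => ∃ a, ⟨b.1, a, b.2⟩ ∈ p))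
    (by
      rintro (a | b) q q' hqq' ⟨c, hc⟩
      · exact ⟨c, hqq' hc⟩
      · exact ⟨c, hqq' hc⟩)
    (by
      rintro (⟨S, a⟩ | ⟨S, b⟩) q hqc hq
      · obtain ⟨b, hb⟩ := hq.exists_insert hL hV hA hB hqc S a
        exact ⟨_, hqc.insert _, hb, Set.subset_insert _ _, b, Set.mem_insert _ _⟩
      · obtain ⟨a, ha⟩ := hq.exists_insert' hL hU hA hB hqc S b
        exact ⟨_, hqc.insert _, ha, Set.subset_insert _ _, a, Set.mem_insert _ _⟩)
  exact hp.isomorphic (fun S a => hR (Sum.inl ⟨S, a⟩)) fun S b => hR (Sum.inr ⟨S, b⟩)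

end
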